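/- Consider the state-dependent Gaussian multiple access channel $Y_i = X_{1,i}+X_{2,i}+S_i+Z_i$, $i=1,\dots,n$, where $S_1,S_2,\dots$ are i.i.d. $\mathcal N(0,Q)$, $Z_1,Z_2,\dots$ are i.i.d. $\mathcal N(0,1)$, the messages $M_1,M_2$ are uniform on finite sets, and messages, state and noise are independent; here $P_1,P_2,Q\ge 0$. The message sets are degraded: encoder 1 maps $(M_1,S^n)$ to $X_1^n$, encoder 2 maps $(M_1,M_2)$ to $X_2^n$, and the decoder maps $Y^n$ to $(\hat M_1,\hat M_2)$. The encoders satisfy the average power constraints $\sum_{i=1}^n \mathbb E[X_{k,i}^2]\le nP_k$, $k=1,2$. Logarithms and rates are taken to an arbitrary fixed base $b>1$. A pair $(R_1,R_2)$ of nonnegative rates is achievable if for every $n$ there is such a code of length $n$ with at least $b^{nR_1}$ messages $M_1$ and at least $b^{nR_2}$ messages $M_2$, such that $\mathbb P[(\hat M_1,\hat M_2)\ne(M_1,M_2)]\to 0$ as $n\to\infty$; the capacity region $\mathcal C_{\mathrm{deg}}(P_1,P_2,Q)$ is the closure of the set of achievable pairs. Then for every $(R_1,R_2)\in\mathcal C_{\mathrm{deg}}(P_1,P_2,Q)$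 there exist $\rho_1\in[0,1]$, $\rho_2\in[0,1]$ and $\rho_s\in[-1,0]$ with $\rho_1^2+\rho_s^2\le 1$ such that $$R_2\le \tfrac12\log\bigl(1+P_2(1-\rho_2^2)\bigr),$$ $$R_2\le \tfrac12\log\bigl(1+P_1(1-\rho_1^2-\rho_s^2)\bigr)+\tfrac12\log\Bigl(1+\frac{P_2(1-\rho_2^2)}{1+(\sqrt Q+\rho_s\sqrt{P_1})^2+P_1(1-\rho_1^2-\rho_s^2)}\Bigr),$$ $$R_1+R_2\le \tfrac12\log\bigl(1+P_1(1-\rho_1^2-\rho_s^2)\bigr)+\tfrac12\log\Bigl(1+\frac{P_2(1-\rho_2^2)+(\rho_2\sqrt{P_2}+\rho_1\sqrt{P_1})^2}{1+(\sqrt Q+\rho_s\sqrt{P_1})^2+P_1(1-\rho_1^2-\rho_s^2)}\Bigr).$$ -/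

import Mathlib

open MeasureTheory ProbabilityTheory Filter Topology
open scoped NNReal

noncomputable section

namespace DirtyMAC

/-- A block code of length `n` for the state-dependent multiple access channel
`Y = X₁ + X₂ + S + Z` with degraded message sets, with `K₁` messages `M₁` and `K₂` messages `M₂`.
Encoder 1 knows `M₁` and the whole state sequence `Sⁿ` (noncausally), encoder 2 knows `M₁` and `M₂`
but not the state, and the decoder sees `Yⁿ` only. -/
structure DegradedCode (n K₁ K₂ : ℕ) where
  enc₁ : Fin K₁ → (Fin n → ℝ) → (Fin n → ℝ)
  measurable_enc₁ : ∀ m₁, Measurable (enc₁ m₁)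
  enc₂ : Fin K₁ → Fin K₂ → (Fin n → ℝ)
  dec : (Fin n → ℝ) → Fin K₁ × Fin K₂
  measurable_dec : Measurable dec

/-- Outcomes `((M₁, M₂), (Sⁿ, Zⁿ))`: the two messages, the state sequence, the noise sequence. -/
abbrev Outcome (n K₁ K₂ : ℕ) : Type :=
  (Fin K₁ × Fin K₂) × ((Fin n → ℝ) × (Fin n → ℝ))

/-- The joint law of messages, state and noise: `(M₁, M₂)` is uniform, `Sⁿ` is i.i.d. `N(0, Q)`,
`Zⁿ` is i.i.d. `N(0, 1)`, and the three are independent. -/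
def law (n K₁ K₂ : ℕ) (Q : ℝ≥0) : Measure (Outcome n K₁ K₂) :=
  (uniformOn (Set.univ : Set (Fin K₁ × Fin K₂))).prod
    ((Measure.pi fun _ : Fin n => gaussianReal 0 Q).prod
      (Measure.pi fun _ : Fin n => gaussianReal 0 1))

namespace DegradedCode

variable {n K₁ K₂ : ℕ} (c : DegradedCode n K₁ K₂)

/-- The input sequence of the state-cognitive encoder. -/
def X₁ (ω : Outcome n K₁ K₂) : Fin n → ℝ := c.enc₁ ω.1.1 ω.2.1

/-- The input sequence of the non-cognitive encoder. -/
def X₂ (ω : Outcome n K₁ K₂) : Fin n → ℝ := c.enc₂ ω.1.1 ω.1.2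

/-- The channel output sequence `Yⁿ = X₁ⁿ + X₂ⁿ + Sⁿ + Zⁿ`. -/
def Y (ω : Outcome n K₁ K₂) : Fin n → ℝ := c.X₁ ω + c.X₂ ω + ω.2.1 + ω.2.2

/-- The average power constraints `∑ᵢ E[X₁ᵢ²] ≤ n P₁` and `∑ᵢ E[X₂ᵢ²] ≤ n P₂`
(the second moments being finite). -/
def PowerConstraint (P₁ P₂ Q : ℝ≥0) : Prop :=
  (∀ i, Integrable (fun ω => (c.X₁ ω i) ^ 2) (law n K₁ K₂ Q)) ∧
  ∑ i, ∫ ω, (c.X₁ ω i) ^ 2 ∂(law n K₁ K₂ Q) ≤ n * P₁ ∧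
  (∀ i, Integrable (fun ω => (c.X₂ ω i) ^ 2) (law n K₁ K₂ Q)) ∧
  ∑ i, ∫ ω, (c.X₂ ω i) ^ 2 ∂(law n K₁ K₂ Q) ≤ n * P₂

/-- The average probability of error `P[(M₁, M₂) ≠ (M̂₁, M̂₂)]`. -/
def errorProb (Q : ℝ≥0) : ℝ :=
  (law n K₁ K₂ Q).real {ω | c.dec (c.Y ω) ≠ ω.1}

end DegradedCode

/-- A pair of nonnegative rates `(R₁, R₂)`, measured with logarithms to base `b`, is achievable if
there are, for every block length `n`, a code with at least `b ^ (n R₁)` messages `M₁` and at least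
`b ^ (n R₂)` messages `M₂` satisfying the power constraints, such that the average probability of
error tends to `0`. -/
def Achievable (b : ℝ) (P₁ P₂ Q : ℝ≥0) (R : ℝ × ℝ) : Prop :=
  0 ≤ R.1 ∧ 0 ≤ R.2 ∧
  ∃ (K₁ K₂ : ℕ → ℕ) (c : ∀ n, DegradedCode n (K₁ n) (K₂ n)),
    (∀ n : ℕ, b ^ ((n : ℝ) * R.1) ≤ (K₁ n : ℝ)) ∧
    (∀ n : ℕ, b ^ ((n : ℝ) * R.2) ≤ (K₂ n : ℝ)) ∧
    (∀ n, (c n).PowerConstraint P₁ P₂ Q) ∧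
    Tendsto (fun n => (c n).errorProb Q) atTop (𝓝 0)

/-- The capacity region with degraded message sets: the closure of the set of achievable pairs. -/
def capacityRegionDeg (b : ℝ) (P₁ P₂ Q : ℝ≥0) : Set (ℝ × ℝ) :=
  closure {R | Achievable b P₁ P₂ Q R}

end DirtyMAC

end

/-!
Fano's inequality is used in a change-of-measure form: if a reference law of state and output has
log-density ratio `L` with respect to the channel and the decoder succeeds under it with probability
at most `1 / K`, then `E[L] + (1 - ε) log K ≤ log 2` by Jensen's inequality. With Gaussian reference
laws `E[L]` depends on the code only through second moments.

For the first bound the reference law keeps the state and, given state and common message, draws the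
output from a Gaussian in which the private message is mere noise of the same power. For the other
two bounds it draws the output from a Gaussian that does not depend on the state, and then the state
around its linear least squares estimate from the output and the messages. The cost of the second
factor is the logarithm of the estimation error; it replaces the term `I(S; Y | M₁, M₂)` of the
entropy argument.

The second moments come from splitting each input into its mean given the common message and an
uncorrelated deviation, and the input of encoder 1 further by its correlation with the state. The
shares of the powers define `ρ₁`, `ρ₂` and `ρs`. These range over a compact set, so the region cut
out by the three inequalities is closed; this absorbs both the vanishing loss `log 2 / n` and the
closure in the capacity region.
-/

noncomputable section

namespace DirtyMAC

open Real
open scoped ENNReal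

section ChangeOfMeasure

variable {Ω : Type*} [MeasurableSpace Ω] {P : Measure Ω} [IsProbabilityMeasure P]

lemma integral_le_log_of_lintegral_exp_le {f : Ω → ℝ} (hf : Integrable f P) {C : ℝ} (hC : 0 < C)
    (h : ∫⁻ ω, .ofReal (rexp (f ω)) ∂P ≤ .ofReal C) : ∫ ω, f ω ∂P ≤ log C := by
  have hmeas : AEStronglyMeasurable (fun ω => rexp (f ω)) P :=
    continuous_exp.comp_aestronglyMeasurable hf.aestronglyMeasurable
  have hnonneg : 0 ≤ᵐ[P] fun ω => rexp (f ω) := ae_of_all _ fun ω => (exp_pos _).le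
  have hexp : Integrable (fun ω => rexp (f ω)) P :=
    ⟨hmeas, (hasFiniteIntegral_iff_ofReal hnonneg).2 (h.trans_lt ENNReal.ofReal_lt_top)⟩
  rw [le_log_iff_exp_le hC]
  calc rexp (∫ ω, f ω ∂P) ≤ ∫ ω, rexp (f ω) ∂P :=
        convexOn_exp.map_integral_le continuous_exp.continuousOn isClosed_univ
          (ae_of_all _ fun _ => Set.mem_univ _) hf hexp
    _ ≤ C := by
        rw [integral_eq_lintegral_of_nonneg_ae hnonneg hmeas]
        exact ENNReal.toReal_le_of_le_ofReal hC.le h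

/-- Change-of-measure form of Fano's inequality: `rexp ∘ L` is the density of a reference law that
charges `A` by at most `K⁻¹`. -/
lemma integral_add_measureReal_mul_log_le {L : Ω → ℝ} (hL : Integrable L P) {A : Set Ω}
    (hA : MeasurableSet A) {K : ℝ} (hK : 0 < K)
    (hLA : ∫⁻ ω in A, .ofReal (rexp (L ω)) ∂P ≤ .ofReal K⁻¹)
    (hL1 : ∫⁻ ω, .ofReal (rexp (L ω)) ∂P ≤ 1) :
    ∫ ω, L ω ∂P + P.real A * log K ≤ log 2 := by
  have hind : Integrable (A.indicator fun _ => log K) P := (integrable_const _).indicator hA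
  have hmean : ∫ ω, (L ω + A.indicator (fun _ => log K) ω) ∂P
      = ∫ ω, L ω ∂P + P.real A * log K := by
    rw [integral_add hL hind, integral_indicator hA, setIntegral_const, smul_eq_mul]
  rw [← hmean]
  refine integral_le_log_of_lintegral_exp_le (hL.add hind) two_pos ?_
  have hin : ∫⁻ ω in A, .ofReal (rexp (L ω + A.indicator (fun _ => log K) ω)) ∂P ≤ 1 := by
    calc _ = ∫⁻ ω in A, .ofReal K * .ofReal (rexp (L ω)) ∂P :=
          setLIntegral_congr_fun hA fun ω hω => by
            rw [Set.indicator_of_mem hω, exp_add, exp_log hK, mul_comm, ENNReal.ofReal_mul hK.le]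
      _ = .ofReal K * ∫⁻ ω in A, .ofReal (rexp (L ω)) ∂P :=
          lintegral_const_mul' _ _ ENNReal.ofReal_ne_top
      _ ≤ .ofReal K * .ofReal K⁻¹ := by gcongr
      _ = 1 := by rw [← ENNReal.ofReal_mul hK.le, mul_inv_cancel₀ hK.ne', ENNReal.ofReal_one]
  have hout : ∫⁻ ω in Aᶜ, .ofReal (rexp (L ω + A.indicator (fun _ => log K) ω)) ∂P ≤ 1 := by
    calc _ = ∫⁻ ω in Aᶜ, .ofReal (rexp (L ω)) ∂P :=
          setLIntegral_congr_fun hA.compl fun ω hω => by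
            rw [Set.indicator_of_notMem hω, add_zero]
      _ ≤ 1 := (setLIntegral_le_lintegral _ _).trans hL1
  rw [← lintegral_add_compl _ hA]
  calc _ ≤ (1 : ℝ≥0∞) + 1 := add_le_add hin hout
    _ = .ofReal 2 := by norm_num

lemma lintegral_lintegral_exp_add_le {α β : Type*} [MeasurableSpace α] [MeasurableSpace β]
    {μ : Measure α} {ν : Measure β} [SFinite μ] [SFinite ν] {f : β → ℝ} {g : α → β → ℝ}
    (hf : Measurable f) (hg : Measurable fun p : α × β => g p.1 p.2)
    (hg1 : ∀ y, ∫⁻ x, .ofReal (rexp (g x y)) ∂μ ≤ 1) :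
    ∫⁻ x, ∫⁻ y, .ofReal (rexp (f y + g x y)) ∂ν ∂μ ≤ ∫⁻ y, .ofReal (rexp (f y)) ∂ν := by
  rw [lintegral_lintegral_swap (((hf.comp measurable_snd).add hg).exp.ennreal_ofReal.aemeasurable)]
  refine lintegral_mono fun y => ?_
  simp only [exp_add, ENNReal.ofReal_mul (exp_pos _).le]
  have hgy : Measurable fun x => ENNReal.ofReal (rexp (g x y)) :=
    (hg.comp measurable_prodMk_right).exp.ennreal_ofReal
  rw [lintegral_const_mul _ hgy]
  exact mul_le_of_le_one_right' (hg1 y)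

end ChangeOfMeasure

section LogGauss

variable {ι : Type*} [Fintype ι]

lemma pi_withDensity_ofReal {α : ι → Type*} [∀ i, MeasurableSpace (α i)]
    {μ : ∀ i, Measure (α i)} [∀ i, SigmaFinite (μ i)] {f : ∀ i, α i → ℝ}
    (hf : ∀ i, Integrable (f i) (μ i)) (hf0 : ∀ i x, 0 ≤ f i x) :
    (Measure.pi fun i => (μ i).withDensity fun x => .ofReal (f i x))
      = (Measure.pi μ).withDensity fun x => .ofReal (∏ i, f i (x i)) := by
  have := fun i => isFiniteMeasure_withDensity_ofReal (hf i).2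
  refine Measure.pi_eq fun s hs => ?_
  have hprod : Integrable (fun x : ∀ i, α i => ∏ i, f i (x i))
      (Measure.pi fun i => (μ i).restrict (s i)) :=
    .fintype_prod_dep fun i => (hf i).restrict
  rw [withDensity_apply _ (.univ_pi hs), Measure.restrict_pi_pi,
    ← ofReal_integral_eq_lintegral_ofReal hprod
      (ae_of_all _ fun x => Finset.prod_nonneg fun i _ => hf0 i _),
    integral_fintype_prod_eq_prod,
    ENNReal.ofReal_prod_of_nonneg fun i _ => integral_nonneg (hf0 i)]
  refine Finset.prod_congr rfl fun i _ => ?_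
  rw [withDensity_apply _ (hs i), ofReal_integral_eq_lintegral_ofReal (hf i).restrict
    (ae_of_all _ (hf0 i))]

/-- The log-density at `y` of a Gaussian vector with mean `μ` and independent coordinates of
variance `v`. For `v = 0` it is `0`, because `x / 0 = 0` and `log 0 = 0`. -/
def logGauss (v : ℝ) (μ y : ι → ℝ) : ℝ :=
  -((y - μ) ⬝ᵥ (y - μ)) / (2 * v) - Fintype.card ι / 2 * log (2 * π * v)

/-- The law of a centred Gaussian vector with independent coordinates of variance `v`. -/
abbrev gaussPi (ι : Type*) [Fintype ι] (v : ℝ≥0) : Measure (ι → ℝ) :=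
  Measure.pi fun _ => gaussianReal 0 v

@[fun_prop]
lemma measurable_logGauss {α : Type*} [MeasurableSpace α] (v : ℝ) {f g : α → ι → ℝ}
    (hf : Measurable f) (hg : Measurable g) : Measurable fun a => logGauss v (f a) (g a) := by
  unfold logGauss
  fun_prop

lemma exp_logGauss {v : ℝ≥0} (hv : v ≠ 0) (μ y : ι → ℝ) :
    rexp (logGauss v μ y) = ∏ i, gaussianPDFReal (μ i) v (y i) := by
  have hv' : (0 : ℝ) < 2 * π * v := by positivity
  have hsqrt : (√(2 * π * v))⁻¹ = rexp (-(log (2 * π * v) / 2)) := by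
    rw [exp_neg, ← log_sqrt hv'.le, exp_log (sqrt_pos.2 hv')]
  simp only [gaussianPDFReal, hsqrt, ← exp_add, ← exp_sum]
  simp only [neg_div, Finset.sum_add_distrib, Finset.sum_neg_distrib, ← Finset.sum_div,
    Finset.sum_const, Finset.card_univ, nsmul_eq_mul, logGauss, dotProduct, Pi.sub_apply, ← sq]
  congr 1
  ring

lemma gaussPi_eq_withDensity (ι : Type*) [Fintype ι] {v : ℝ≥0} (hv : v ≠ 0) :
    gaussPi ι v = volume.withDensity fun y => .ofReal (rexp (logGauss v 0 y)) := by
  simp only [gaussPi, exp_logGauss hv, gaussianReal_of_var_ne_zero _ hv]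
  exact pi_withDensity_ofReal (fun _ => integrable_gaussianPDFReal 0 v)
    fun _ => gaussianPDFReal_nonneg 0 v

lemma lintegral_gaussPi {v : ℝ≥0} (hv : v ≠ 0) (f : (ι → ℝ) → ℝ≥0∞) :
    ∫⁻ y, f y ∂gaussPi ι v = ∫⁻ y, .ofReal (rexp (logGauss v 0 y)) * f y := by
  rw [gaussPi_eq_withDensity ι hv, lintegral_withDensity_eq_lintegral_mul_non_measurable _
    (by fun_prop) (ae_of_all _ fun _ => ENNReal.ofReal_lt_top)]
  rfl

lemma lintegral_exp_logGauss {v : ℝ} (hv : 0 < v) (μ : ι → ℝ) :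
    ∫⁻ y, .ofReal (rexp (logGauss v μ y)) = 1 := by
  lift v to ℝ≥0 using hv.le
  have hcentred : ∫⁻ y : ι → ℝ, .ofReal (rexp (logGauss v 0 y)) = 1 := by
    simpa using (lintegral_gaussPi (ι := ι) (NNReal.coe_ne_zero.1 hv.ne') 1).symm
  rw [← hcentred, ← lintegral_sub_right_eq_self (fun y => .ofReal (rexp (logGauss v 0 y))) μ]
  simp only [logGauss, sub_zero]

lemma lintegral_exp_logGauss_sub_le {v : ℝ≥0} {r : ℝ} (hr : 0 < r) (μ : ι → ℝ) :
    ∫⁻ s, .ofReal (rexp (logGauss (r * v) μ s - logGauss v 0 s)) ∂gaussPi ι v ≤ 1 := by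
  by_cases hv : v = 0
  · simp [logGauss, hv]
  · rw [lintegral_gaussPi hv, ← lintegral_exp_logGauss (v := r * v) (by positivity) μ]
    refine (lintegral_congr fun s => ?_).le
    rw [← ENNReal.ofReal_mul (exp_pos _).le, ← exp_add, add_sub_cancel]

lemma lintegral_gaussPi_translate {v : ℝ≥0} (hv : v ≠ 0) (t : ι → ℝ) (f : (ι → ℝ) → ℝ≥0∞) :
    ∫⁻ z, f (t + z) * .ofReal (rexp (-logGauss v 0 z)) ∂gaussPi ι v = ∫⁻ y, f y := by
  rw [lintegral_gaussPi hv, ← lintegral_add_left_eq_self f t]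
  refine lintegral_congr fun z => ?_
  rw [mul_left_comm, ← ENNReal.ofReal_mul (exp_pos _).le, ← exp_add, add_neg_cancel, exp_zero,
    ENNReal.ofReal_one, mul_one]

end LogGauss

section SecondMoments

variable {Ω ι : Type*} [Fintype ι] [MeasurableSpace Ω] {P : Measure Ω} {F G H : Ω → ι → ℝ}

/-- The second moment `E[∑ᵢ Fᵢ Gᵢ]` of two random vectors, normalized by the dimension. -/
def avgCorr (P : Measure Ω) (F G : Ω → ι → ℝ) : ℝ :=
  (Fintype.card ι : ℝ)⁻¹ * ∫ ω, F ω ⬝ᵥ G ω ∂P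

/-- The average power per coordinate of a random vector. -/
def avgPow (P : Measure Ω) (F : Ω → ι → ℝ) : ℝ := avgCorr P F F

lemma integrable_apply_mul_apply (hF : MemLp F 2 P) (hG : MemLp G 2 P) (i : ι) :
    Integrable (fun ω => F ω i * G ω i) P :=
  (hF.eval i).integrable_mul (hG.eval i)

lemma integrable_dotProduct (hF : MemLp F 2 P) (hG : MemLp G 2 P) :
    Integrable (fun ω => F ω ⬝ᵥ G ω) P :=
  integrable_finsetSum _ fun i _ => integrable_apply_mul_apply hF hG i

lemma avgCorr_eq_sum (hF : MemLp F 2 P) (hG : MemLp G 2 P) :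
    avgCorr P F G = (Fintype.card ι : ℝ)⁻¹ * ∑ i, ∫ ω, F ω i * G ω i ∂P := by
  rw [avgCorr, ← integral_finsetSum _ fun i _ => integrable_apply_mul_apply hF hG i]
  rfl

lemma avgCorr_comm (P : Measure Ω) (F G : Ω → ι → ℝ) : avgCorr P F G = avgCorr P G F := by
  simp only [avgCorr, dotProduct_comm]

lemma avgCorr_add_left (hF : MemLp F 2 P) (hG : MemLp G 2 P) (hH : MemLp H 2 P) :
    avgCorr P (F + G) H = avgCorr P F H + avgCorr P G H := by
  simp only [avgCorr, Pi.add_apply, add_dotProduct]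
  rw [integral_add (integrable_dotProduct hF hH) (integrable_dotProduct hG hH), mul_add]

lemma avgCorr_add_right (hF : MemLp F 2 P) (hG : MemLp G 2 P) (hH : MemLp H 2 P) :
    avgCorr P H (F + G) = avgCorr P H F + avgCorr P H G := by
  simp only [avgCorr_comm P H, avgCorr_add_left hF hG hH]

lemma avgCorr_smul_left (a : ℝ) : avgCorr P (a • F) G = a * avgCorr P F G := by
  simp only [avgCorr, Pi.smul_apply, smul_dotProduct, smul_eq_mul, integral_const_mul]
  ring

lemma avgPow_nonneg : 0 ≤ avgPow P F :=
  mul_nonneg (by positivity)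
    (integral_nonneg fun ω => Finset.sum_nonneg fun i _ => mul_self_nonneg (F ω i))

lemma avgPow_smul (a : ℝ) : avgPow P (a • F) = a ^ 2 * avgPow P F := by
  rw [avgPow, avgCorr_smul_left, avgCorr_comm, avgCorr_smul_left, avgPow]
  ring

lemma avgPow_add (hF : MemLp F 2 P) (hG : MemLp G 2 P) :
    avgPow P (F + G) = avgPow P F + 2 * avgCorr P F G + avgPow P G := by
  simp only [avgPow]
  rw [avgCorr_add_left hF hG (hF.add hG), avgCorr_add_right hF hG hF, avgCorr_add_right hF hG hG,
    avgCorr_comm P G F]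
  ring

lemma avgPow_add_of_avgCorr_eq_zero (hF : MemLp F 2 P) (hG : MemLp G 2 P)
    (h : avgCorr P F G = 0) : avgPow P (F + G) = avgPow P F + avgPow P G := by
  rw [avgPow_add hF hG, h, mul_zero, add_zero]

lemma avgPow_add_smul (hF : MemLp F 2 P) (hG : MemLp G 2 P) (a : ℝ) :
    avgPow P (F + a • G) = avgPow P F + 2 * a * avgCorr P F G + a ^ 2 * avgPow P G := by
  rw [avgPow_add hF (hG.const_smul a), avgPow_smul, avgCorr_comm, avgCorr_smul_left,
    avgCorr_comm P G F]
  ring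

lemma avgCorr_sq_le (hF : MemLp F 2 P) (hG : MemLp G 2 P) :
    avgCorr P F G ^ 2 ≤ avgPow P F * avgPow P G := by
  have h := discrim_le_zero (a := avgPow P G) (b := 2 * avgCorr P F G) (c := avgPow P F)
    fun t => by
      have := avgPow_add_smul hF hG t ▸ avgPow_nonneg (P := P) (F := F + t • G)
      linarith
  rw [discrim] at h
  linarith

lemma avgPow_add_le_sq_sqrt_add_sqrt (hF : MemLp F 2 P) (hG : MemLp G 2 P) :
    avgPow P (F + G) ≤ (√(avgPow P F) + √(avgPow P G)) ^ 2 := by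
  have h : avgCorr P F G ≤ √(avgPow P F) * √(avgPow P G) := by
    rw [← sqrt_mul avgPow_nonneg]
    exact le_sqrt_of_sq_le (avgCorr_sq_le hF hG)
  rw [avgPow_add hF hG, add_sq, sq_sqrt avgPow_nonneg, sq_sqrt avgPow_nonneg]
  linarith

/-- The residual of the best linear estimate of `F` from `G`. -/
lemma avgPow_sub_smul_div (hF : MemLp F 2 P) (hG : MemLp G 2 P) (hG0 : avgPow P G ≠ 0) :
    avgPow P (F - (avgCorr P F G / avgPow P G) • G)
      = avgPow P F - avgCorr P F G ^ 2 / avgPow P G := by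
  rw [sub_eq_add_neg, ← neg_smul, avgPow_add_smul hF hG]
  field_simp
  ring

variable [IsProbabilityMeasure P]

lemma integrable_logGauss (v : ℝ) (hF : MemLp F 2 P) (hG : MemLp G 2 P) :
    Integrable (fun ω => logGauss v (F ω) (G ω)) P :=
  ((integrable_dotProduct (hG.sub hF) (hG.sub hF)).neg.div_const _).sub (integrable_const _)

lemma integral_logGauss (v : ℝ) (hF : MemLp F 2 P) (hG : MemLp G 2 P) :
    ∫ ω, logGauss v (F ω) (G ω) ∂P
      = -(Fintype.card ι / 2 * (avgPow P (G - F) / v + log (2 * π * v))) := by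
  have hcard : (Fintype.card ι : ℝ) * avgPow P (G - F) = ∫ ω, (G - F) ω ⬝ᵥ (G - F) ω ∂P := by
    cases isEmpty_or_nonempty ι
    · simp
    · exact mul_inv_cancel_left₀ (by simp) _
  have hint := (integrable_dotProduct (hG.sub hF) (hG.sub hF)).neg.div_const (2 * v)
  calc _ = -(∫ ω, (G - F) ω ⬝ᵥ (G - F) ω ∂P) / (2 * v)
        - Fintype.card ι / 2 * log (2 * π * v) := by
        rw [← integral_neg, ← integral_div]
        exact (integral_sub hint (integrable_const _)).trans (by simp)
    _ = _ := by rw [← hcard]; ring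

lemma integral_logGauss_sub_logGauss {v w : ℝ} {F' G' : Ω → ι → ℝ} (hF : MemLp F 2 P)
    (hG : MemLp G 2 P) (hF' : MemLp F' 2 P) (hG' : MemLp G' 2 P) (hv : avgPow P (G - F) = v)
    (hw : avgPow P (G' - F') = w) (hv0 : v ≠ 0) (hw0 : w ≠ 0) :
    ∫ ω, (logGauss v (F ω) (G ω) - logGauss w (F' ω) (G' ω)) ∂P
      = -(Fintype.card ι / 2 * log (v / w)) := by
  rw [integral_sub (integrable_logGauss v hF hG) (integrable_logGauss w hF' hG'),
    integral_logGauss v hF hG, integral_logGauss w hF' hG', hv, hw, div_self hv0, div_self hw0,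
    log_mul (by positivity) hv0, log_mul (by positivity) hw0, log_div hv0 hw0]
  ring

end SecondMoments

section Law

variable {ι : Type*} [Fintype ι]

lemma uniformOn_univ_eq_smul_count (α : Type*) [Fintype α] [MeasurableSpace α]
    [MeasurableSingletonClass α] :
    uniformOn (Set.univ : Set α) = (Fintype.card α : ℝ≥0∞)⁻¹ • Measure.count := by
  rw [uniformOn, ProbabilityTheory.cond, Measure.restrict_univ]
  simp [Measure.count_apply_finite]

instance isProbabilityMeasure_uniformOn_univ (α : Type*) [Finite α] [Nonempty α]
    [MeasurableSpace α] [MeasurableSingletonClass α] :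
    IsProbabilityMeasure (uniformOn (Set.univ : Set α)) :=
  isProbabilityMeasure_uniformOn Set.finite_univ Set.univ_nonempty

lemma integral_prod_eq_zero_of_forall {α β : Type*} [MeasurableSpace α] [MeasurableSpace β]
    {μ : Measure α} {ν : Measure β} [SFinite μ] [SFinite ν] {f : α × β → ℝ}
    (h : ∀ x, ∫ y, f (x, y) ∂ν = 0) : ∫ p, f p ∂μ.prod ν = 0 := by
  by_cases hf : Integrable f (μ.prod ν)
  · rw [integral_prod _ hf]
    simp only [h, integral_zero]
  · exact integral_undef hf

lemma memLp_id_gaussPi (ι : Type*) [Fintype ι] (v : ℝ≥0) :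
    MemLp (fun z : ι → ℝ => z) 2 (gaussPi ι v) :=
  .of_eval fun i => (memLp_id_gaussianReal' 2 (by simp)).comp_measurePreserving
    (measurePreserving_eval (fun _ : ι => gaussianReal 0 v) i)

lemma integral_apply_gaussPi (v : ℝ≥0) (i : ι) : ∫ z, z i ∂gaussPi ι v = 0 := by
  rw [integral_comp_eval (μ := fun _ : ι => gaussianReal 0 v) (f := fun x : ℝ => x)
    (by fun_prop), integral_id_gaussianReal]

lemma avgPow_gaussPi [Nonempty ι] (v : ℝ≥0) : avgPow (gaussPi ι v) (fun z => z) = v := by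
  have hsq : ∀ i, ∫ z, z i * z i ∂gaussPi ι v = v := fun i => by
    rw [integral_comp_eval (μ := fun _ : ι => gaussianReal 0 v) (f := fun x : ℝ => x * x)
      (by fun_prop)]
    simpa only [variance_of_integral_eq_zero aemeasurable_id' integral_id_gaussianReal, sq]
      using variance_fun_id_gaussianReal (μ := 0) (v := v)
  rw [avgPow, avgCorr_eq_sum (memLp_id_gaussPi ι v) (memLp_id_gaussPi ι v)]
  simp only [hsq, Finset.sum_const, Finset.card_univ, nsmul_eq_mul]
  exact inv_mul_cancel_left₀ (by simp) _

variable {n K₁ K₂ : ℕ} {Q : ℝ≥0}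

/-- The state sequence `Sⁿ` as a random vector. -/
def state (ω : Outcome n K₁ K₂) : Fin n → ℝ := ω.2.1

/-- The noise sequence `Zⁿ` as a random vector. -/
def noise (ω : Outcome n K₁ K₂) : Fin n → ℝ := ω.2.2

lemma lintegral_law {F : Outcome n K₁ K₂ → ℝ≥0∞} (hF : Measurable F) :
    ∫⁻ ω, F ω ∂law n K₁ K₂ Q = ((K₁ : ℝ≥0∞) * K₂)⁻¹ *
      ∑ m, ∫⁻ s, ∫⁻ z, F (m, (s, z)) ∂gaussPi (Fin n) 1 ∂gaussPi (Fin n) Q := by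
  rw [law, uniformOn_univ_eq_smul_count, Measure.prod_smul_left, lintegral_smul_measure,
    lintegral_prod _ hF.aemeasurable, lintegral_count, tsum_fintype, smul_eq_mul]
  congr 1
  · simp
  · exact Finset.sum_congr rfl fun m _ => lintegral_prod _ (by fun_prop)

lemma integral_law_message (f : Fin K₁ × Fin K₂ → ℝ) :
    ∫ ω, f ω.1 ∂law n K₁ K₂ Q = ((K₁ : ℝ) * K₂)⁻¹ * ∑ m, f m := by
  rw [law, integral_fun_fst, uniformOn_univ_eq_smul_count, integral_smul_measure, integral_count]
  simp

instance isProbabilityMeasure_law [NeZero K₁] [NeZero K₂] :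
    IsProbabilityMeasure (law n K₁ K₂ Q) := by
  unfold law
  infer_instance

lemma memLp_message (f : Fin K₁ × Fin K₂ → Fin n → ℝ) :
    MemLp (fun ω => f ω.1) 2 (law n K₁ K₂ Q) :=
  (MemLp.of_discrete (f := f)).comp_fst _

lemma memLp_state : MemLp state 2 (law n K₁ K₂ Q) :=
  ((memLp_id_gaussPi (Fin n) Q).comp_fst _).comp_snd _

lemma memLp_noise : MemLp noise 2 (law n K₁ K₂ Q) :=
  ((memLp_id_gaussPi (Fin n) 1).comp_snd _).comp_snd _

lemma avgPow_state [NeZero n] [NeZero K₁] [NeZero K₂] : avgPow (law n K₁ K₂ Q) state = Q := by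
  rw [← avgPow_gaussPi (ι := Fin n) Q]
  simp only [avgPow, avgCorr, law, state]
  rw [integral_fun_snd (f := fun p : (Fin n → ℝ) × (Fin n → ℝ) => p.1 ⬝ᵥ p.1),
    integral_fun_fst (f := fun s : Fin n → ℝ => s ⬝ᵥ s)]
  simp

lemma avgPow_noise [NeZero n] [NeZero K₁] [NeZero K₂] : avgPow (law n K₁ K₂ Q) noise = 1 := by
  rw [← NNReal.coe_one, ← avgPow_gaussPi (ι := Fin n) 1]
  simp only [avgPow, avgCorr, law, noise]
  rw [integral_fun_snd (f := fun p : (Fin n → ℝ) × (Fin n → ℝ) => p.2 ⬝ᵥ p.2),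
    integral_fun_snd (f := fun s : Fin n → ℝ => s ⬝ᵥ s)]
  simp

variable {F G : Outcome n K₁ K₂ → Fin n → ℝ}

lemma avgCorr_eq_zero_of_forall_integral (hF : MemLp F 2 (law n K₁ K₂ Q))
    (hG : MemLp G 2 (law n K₁ K₂ Q))
    (h : ∀ m i, ∫ p, F (m, p) i * G (m, p) i ∂(gaussPi (Fin n) Q).prod (gaussPi (Fin n) 1) = 0) :
    avgCorr (law n K₁ K₂ Q) F G = 0 := by
  rw [avgCorr_eq_sum hF hG, Finset.sum_eq_zero fun i _ => ?_, mul_zero]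
  exact integral_prod_eq_zero_of_forall fun m => h m i

lemma avgCorr_noise_eq_zero {g : Fin K₁ × Fin K₂ → (Fin n → ℝ) → Fin n → ℝ}
    (hg : MemLp (fun ω => g ω.1 (state ω)) 2 (law n K₁ K₂ Q)) :
    avgCorr (law n K₁ K₂ Q) (fun ω => g ω.1 (state ω)) noise = 0 :=
  avgCorr_eq_zero_of_forall_integral hg memLp_noise fun m i => by
    refine (integral_prod_mul (fun s => g m s i) fun z : Fin n → ℝ => z i).trans ?_
    rw [integral_apply_gaussPi, mul_zero]

lemma avgCorr_message_eq_zero (f : Fin K₁ × Fin K₂ → Fin n → ℝ)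
    {g : Fin K₁ × Fin K₂ → (Fin n → ℝ) → Fin n → ℝ}
    (hg : MemLp (fun ω => g ω.1 (state ω)) 2 (law n K₁ K₂ Q))
    (hg0 : ∀ m i, ∫ s, g m s i ∂gaussPi (Fin n) Q = 0) :
    avgCorr (law n K₁ K₂ Q) (fun ω => f ω.1) (fun ω => g ω.1 (state ω)) = 0 :=
  avgCorr_eq_zero_of_forall_integral (memLp_message f) hg fun m i => by
    simp only [state]
    rw [integral_const_mul, integral_fun_fst (f := fun s => g m s i), hg0, smul_zero, mul_zero]

lemma avgCorr_message₁_eq_zero (f : Fin K₁ → Fin n → ℝ) {g : Fin K₁ × Fin K₂ → Fin n → ℝ}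
    (hg : ∀ m₁, ∑ m₂, g (m₁, m₂) = 0) :
    avgCorr (law n K₁ K₂ Q) (fun ω => f ω.1.1) (fun ω => g ω.1) = 0 := by
  rw [avgCorr, integral_law_message fun m => f m.1 ⬝ᵥ g m, Fintype.sum_prod_type]
  simp only [← dotProduct_sum, hg, dotProduct_zero, Finset.sum_const_zero, mul_zero]

end Law

section DecodingSets

variable {α β γ : Type*} [MeasurableSpace α] [MeasurableSpace β] [MeasurableSingletonClass β]
  {μ : Measure α}

lemma sum_setLIntegral_preimage_singleton_le {d : α → β} (hd : Measurable d) (f : α → ℝ≥0∞)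
    (T : Finset β) : ∑ b ∈ T, ∫⁻ y in d ⁻¹' {b}, f y ∂μ ≤ ∫⁻ y, f y ∂μ := by
  rw [← lintegral_biUnion_finset]
  · exact setLIntegral_le_lintegral _ _
  · exact fun b _ b' _ hne =>
      Set.disjoint_left.2 fun y hy hy' => hne (hy.symm.trans hy')
  · exact fun b _ => hd (measurableSet_singleton b)

lemma sum_setLIntegral_preimage_singleton_le_card [Fintype β] [Fintype γ] [MeasurableSpace γ]
    [MeasurableSingletonClass γ] {d : α → β × γ} (hd : Measurable d) {f : β → α → ℝ≥0∞}
    (hf : ∀ b, ∫⁻ y, f b y ∂μ ≤ 1) :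
    ∑ m, ∫⁻ y in d ⁻¹' {m}, f m.1 y ∂μ ≤ Fintype.card β := by
  have hfibre : ∀ b, ∑ g, ∫⁻ y in d ⁻¹' {(b, g)}, f b y ∂μ ≤ 1 := fun b => by
    refine le_trans ?_ (hf b)
    have h := sum_setLIntegral_preimage_singleton_le (μ := μ) hd (f b)
      (Finset.univ.map ⟨fun g : γ => (b, g), Prod.mk_right_injective b⟩)
    rwa [Finset.sum_map] at h
  rw [Fintype.sum_prod_type]
  simpa using Finset.sum_le_sum fun b (_ : b ∈ Finset.univ) => hfibre b

end DecodingSets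

namespace DegradedCode

variable {n K₁ K₂ : ℕ} {Q : ℝ≥0} (c : DegradedCode n K₁ K₂)

section Reference

lemma measurable_X₁ : Measurable c.X₁ :=
  measurable_from_prod_countable_right fun m => (c.measurable_enc₁ m.1).comp measurable_fst

lemma measurable_X₂ : Measurable c.X₂ := by
  unfold X₂
  fun_prop

lemma measurable_Y : Measurable c.Y :=
  ((c.measurable_X₁.add c.measurable_X₂).add measurable_snd.fst).add measurable_snd.snd

lemma measurableSet_correct : MeasurableSet {ω : Outcome n K₁ K₂ | c.dec (c.Y ω) = ω.1} :=
  measurableSet_eq_fun (c.measurable_dec.comp c.measurable_Y) measurable_fst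

lemma measurableSet_decoded (m : Fin K₁ × Fin K₂) : MeasurableSet (c.dec ⁻¹' {m}) :=
  c.measurable_dec (measurableSet_singleton m)

/-- Undoing the noise density turns the noise law into Lebesgue measure, which is invariant under
the translation by the noiseless output. -/
lemma lintegral_law_mul_exp_neg_logGauss {F : Fin K₁ × Fin K₂ → (Fin n → ℝ) → (Fin n → ℝ) → ℝ≥0∞}
    (hF : ∀ m, Measurable fun p : (Fin n → ℝ) × (Fin n → ℝ) => F m p.1 p.2) :
    ∫⁻ ω, F ω.1 (state ω) (c.Y ω) * .ofReal (rexp (-logGauss 1 0 (noise ω))) ∂law n K₁ K₂ Q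
      = ((K₁ : ℝ≥0∞) * K₂)⁻¹ * ∑ m, ∫⁻ s, ∫⁻ y, F m s y ∂volume ∂gaussPi (Fin n) Q := by
  have hmeas : Measurable fun ω : Outcome n K₁ K₂ =>
      F ω.1 (state ω) (c.Y ω) * .ofReal (rexp (-logGauss 1 0 (noise ω))) := by
    unfold state noise
    refine measurable_from_prod_countable_right fun m => ?_
    exact ((hF m).comp (measurable_fst.prodMk (c.measurable_Y.comp measurable_prodMk_left))).mul
      (by fun_prop)
  rw [lintegral_law hmeas]
  congr 1
  refine Finset.sum_congr rfl fun m _ => lintegral_congr fun s => ?_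
  exact mod_cast lintegral_gaussPi_translate one_ne_zero
    (c.enc₁ m.1 s + c.enc₂ m.1 m.2 + s) (F m s)

variable [NeZero K₁] [NeZero K₂]

lemma one_sub_errorProb :
    1 - c.errorProb Q = (law n K₁ K₂ Q).real {ω | c.dec (c.Y ω) = ω.1} := by
  rw [errorProb, ← Set.compl_ofPred, probReal_compl_eq_one_sub c.measurableSet_correct,
    sub_sub_cancel]

/-- `W m` is the log-density, relative to the product of the state law and Lebesgue measure, of a
reference law of state and output given the messages `m`. Under the reference law decoding succeeds
with probability at most `J / (K₁ K₂)`. -/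
theorem integral_add_mul_log_le_of_reference
    {W : Fin K₁ × Fin K₂ → (Fin n → ℝ) → (Fin n → ℝ) → ℝ}
    (hW : ∀ m, Measurable fun p : (Fin n → ℝ) × (Fin n → ℝ) => W m p.1 p.2)
    (hL : Integrable (fun ω => W ω.1 (state ω) (c.Y ω) - logGauss 1 0 (noise ω)) (law n K₁ K₂ Q))
    (hone : ∀ m, ∫⁻ s, ∫⁻ y, .ofReal (rexp (W m s y)) ∂volume ∂gaussPi (Fin n) Q ≤ 1)
    {J : ℕ} (hJ : 0 < J)
    (hdec : ∑ m, ∫⁻ s, ∫⁻ y in c.dec ⁻¹' {m}, .ofReal (rexp (W m s y)) ∂volume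
      ∂gaussPi (Fin n) Q ≤ J) :
    ∫ ω, (W ω.1 (state ω) (c.Y ω) - logGauss 1 0 (noise ω)) ∂law n K₁ K₂ Q
      + (1 - c.errorProb Q) * log (K₁ * K₂ / J) ≤ log 2 := by
  have hk₁ : (0 : ℝ) < K₁ := by exact_mod_cast NeZero.pos K₁
  have hk₂ : (0 : ℝ) < K₂ := by exact_mod_cast NeZero.pos K₂
  have : (0 : ℝ) < J := by exact_mod_cast hJ
  have hexpW : ∀ m, Measurable fun p : (Fin n → ℝ) × (Fin n → ℝ) =>
      ENNReal.ofReal (rexp (W m p.1 p.2)) := fun m => (hW m).exp.ennreal_ofReal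
  have hexpL : ∀ ω, ENNReal.ofReal (rexp (W ω.1 (state ω) (c.Y ω) - logGauss 1 0 (noise ω)))
      = .ofReal (rexp (W ω.1 (state ω) (c.Y ω))) * .ofReal (rexp (-logGauss 1 0 (noise ω))) :=
    fun ω => by rw [sub_eq_add_neg, exp_add, ENNReal.ofReal_mul (exp_pos _).le]
  rw [one_sub_errorProb]
  refine integral_add_measureReal_mul_log_le hL c.measurableSet_correct (by positivity) ?_ ?_
  · have hind := c.lintegral_law_mul_exp_neg_logGauss (Q := Q)
      (F := fun m s => (c.dec ⁻¹' {m}).indicator fun y => .ofReal (rexp (W m s y)))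
      fun m => (hexpW m).indicator (measurable_snd (c.measurableSet_decoded m))
    simp only [lintegral_indicator (c.measurableSet_decoded _)] at hind
    rw [← lintegral_indicator c.measurableSet_correct]
    calc _ = ((K₁ : ℝ≥0∞) * K₂)⁻¹ * ∑ m, ∫⁻ s, ∫⁻ y in c.dec ⁻¹' {m},
            .ofReal (rexp (W m s y)) ∂volume ∂gaussPi (Fin n) Q := by
          rw [← hind]
          refine lintegral_congr fun ω => ?_
          by_cases hω : c.dec (c.Y ω) = ω.1 <;> simp [Set.indicator, hω, hexpL]
      _ ≤ ((K₁ : ℝ≥0∞) * K₂)⁻¹ * J := by gcongr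
      _ = .ofReal (K₁ * K₂ / J)⁻¹ := by
          rw [inv_div, ENNReal.ofReal_div_of_pos (by positivity), ENNReal.ofReal_mul hk₁.le]
          simp [ENNReal.div_eq_inv_mul]
  · simp only [hexpL]
    rw [c.lintegral_law_mul_exp_neg_logGauss (F := fun m s y => .ofReal (rexp (W m s y))) hexpW]
    calc _ ≤ ((K₁ : ℝ≥0∞) * K₂)⁻¹ * ∑ _m : Fin K₁ × Fin K₂, 1 := by
          gcongr with m; exact hone m
      _ = 1 := by
          rw [Finset.sum_const, Finset.card_univ, nsmul_one, Fintype.card_prod, Fintype.card_fin,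
            Fintype.card_fin, Nat.cast_mul]
          exact ENNReal.inv_mul_cancel (by simp [NeZero.ne]) (by simp [ENNReal.mul_eq_top])

end Reference

section Statistics

variable (Q) in
/-- The conditional mean `E[X₁ | M₁ = m₁]`. -/
def mean₁ (m₁ : Fin K₁) : Fin n → ℝ := fun i => ∫ s, c.enc₁ m₁ s i ∂gaussPi (Fin n) Q

/-- The conditional mean `E[X₂ | M₁ = m₁]`. -/
def mean₂ (m₁ : Fin K₁) : Fin n → ℝ := (K₂ : ℝ)⁻¹ • ∑ m₂, c.enc₂ m₁ m₂

variable (Q) in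
/-- The part `X₁ - E[X₁ | M₁]` of the first input, which is due to the state. -/
def dev₁ (ω : Outcome n K₁ K₂) : Fin n → ℝ := c.X₁ ω - c.mean₁ Q ω.1.1

/-- The part `X₂ - E[X₂ | M₁]` of the second input, which is due to the private message. -/
def dev₂ (ω : Outcome n K₁ K₂) : Fin n → ℝ := c.X₂ ω - c.mean₂ ω.1.1

variable (Q) in
/-- The part `Y - E[Y | M₁, M₂]` of the output, which is due to the state and the noise. -/
def fluct : Outcome n K₁ K₂ → Fin n → ℝ := c.dev₁ Q + state + noise

variable (Q) in
/-- The power of `E[X₁ | M₁]`. -/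
def meanPow₁ : ℝ := avgPow (law n K₁ K₂ Q) fun ω => c.mean₁ Q ω.1.1

variable (Q) in
/-- The power of `E[X₂ | M₁]`. -/
def meanPow₂ : ℝ := avgPow (law n K₁ K₂ Q) fun ω => c.mean₂ ω.1.1

variable (Q) in
/-- The power of `X₁ - E[X₁ | M₁]`. -/
def var₁ : ℝ := avgPow (law n K₁ K₂ Q) (c.dev₁ Q)

variable (Q) in
/-- The power of `X₂ - E[X₂ | M₁]`. -/
def var₂ : ℝ := avgPow (law n K₁ K₂ Q) c.dev₂

variable (Q) in
/-- The correlation of the first input with the state; the mean given `M₁` does not contribute. -/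
def stateCorr : ℝ := avgCorr (law n K₁ K₂ Q) (c.dev₁ Q) state

variable (Q) in
/-- The part of `var₁` not explained linearly by the state. For `Q = 0` the quotient is `0`,
which is right since then `stateCorr` vanishes. -/
def resVar₁ : ℝ := c.var₁ Q - c.stateCorr Q ^ 2 / Q

variable (Q) in
/-- The power of `Y - E[Y | M₁, M₂]`. -/
def fluctPow : ℝ := avgPow (law n K₁ K₂ Q) (c.fluct Q)

variable (Q) in
/-- The coefficient of the best linear estimate of the state from the output and the messages. -/
def mmseCoeff : ℝ := (Q + c.stateCorr Q) / c.fluctPow Q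

variable (Q) in
/-- The mean square error of the best linear estimate of the state from the output and the messages,
relative to the power of the state. -/
def mmseRatio : ℝ := (1 + c.resVar₁ Q) / c.fluctPow Q

lemma Y_eq_add_fluct (ω : Outcome n K₁ K₂) :
    c.Y ω = c.mean₁ Q ω.1.1 + c.X₂ ω + c.fluct Q ω := by
  simp only [Y, fluct, dev₁, state, noise, Pi.add_apply]
  abel

lemma X₂_eq_add_dev₂ : c.X₂ = (fun ω => c.mean₂ ω.1.1) + c.dev₂ := by
  funext ω
  rw [Pi.add_apply, dev₂, add_sub_cancel]

lemma memLp_X₂ : MemLp c.X₂ 2 (law n K₁ K₂ Q) := memLp_message fun m => c.enc₂ m.1 m.2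

lemma memLp_mean₁ : MemLp (fun ω => c.mean₁ Q ω.1.1) 2 (law n K₁ K₂ Q) :=
  memLp_message fun m => c.mean₁ Q m.1

lemma memLp_mean₂ : MemLp (fun ω => c.mean₂ ω.1.1) 2 (law n K₁ K₂ Q) :=
  memLp_message fun m => c.mean₂ m.1

lemma memLp_dev₂ : MemLp c.dev₂ 2 (law n K₁ K₂ Q) := c.memLp_X₂.sub c.memLp_mean₂

lemma meanPow₁_nonneg : 0 ≤ c.meanPow₁ Q := avgPow_nonneg

lemma meanPow₂_nonneg : 0 ≤ c.meanPow₂ Q := avgPow_nonneg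

lemma var₁_nonneg : 0 ≤ c.var₁ Q := avgPow_nonneg

lemma var₂_nonneg : 0 ≤ c.var₂ Q := avgPow_nonneg

lemma sum_enc₂_sub_mean₂ [NeZero K₂] (m₁ : Fin K₁) :
    ∑ m₂, (c.enc₂ m₁ m₂ - c.mean₂ m₁) = 0 := by
  rw [Finset.sum_sub_distrib, Finset.sum_const, Finset.card_univ, Fintype.card_fin, mean₂,
    ← Nat.cast_smul_eq_nsmul ℝ, smul_inv_smul₀ (NeZero.ne (K₂ : ℝ)), sub_self]

lemma avgPow_add_dev₂ [NeZero K₂] (f : Fin K₁ → Fin n → ℝ) :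
    avgPow (law n K₁ K₂ Q) ((fun ω => f ω.1.1) + c.dev₂)
      = avgPow (law n K₁ K₂ Q) (fun ω => f ω.1.1) + c.var₂ Q :=
  avgPow_add_of_avgCorr_eq_zero (memLp_message fun m => f m.1) c.memLp_dev₂
    (avgCorr_message₁_eq_zero f (g := fun m => c.enc₂ m.1 m.2 - c.mean₂ m.1) c.sum_enc₂_sub_mean₂)

lemma integral_enc₁_sub_mean₁ (m₁ : Fin K₁) (i : Fin n) :
    ∫ s, (c.enc₁ m₁ s - c.mean₁ Q m₁) i ∂gaussPi (Fin n) Q = 0 := by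
  simpa only [mean₁, average_eq_integral, Pi.sub_apply]
    using integral_sub_average (gaussPi (Fin n) Q) fun s => c.enc₁ m₁ s i

section SquareIntegrable

variable {c} (hX : MemLp c.X₁ 2 (law n K₁ K₂ Q))
include hX

lemma memLp_dev₁ : MemLp (c.dev₁ Q) 2 (law n K₁ K₂ Q) := hX.sub c.memLp_mean₁

lemma memLp_fluct : MemLp (c.fluct Q) 2 (law n K₁ K₂ Q) :=
  ((memLp_dev₁ hX).add memLp_state).add memLp_noise

lemma avgPow_X₁ : avgPow (law n K₁ K₂ Q) c.X₁ = c.meanPow₁ Q + c.var₁ Q := by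
  have hsplit : c.X₁ = (fun ω => c.mean₁ Q ω.1.1) + c.dev₁ Q := by
    funext ω
    rw [Pi.add_apply, dev₁, add_sub_cancel]
  rw [hsplit]
  exact avgPow_add_of_avgCorr_eq_zero c.memLp_mean₁ (memLp_dev₁ hX)
    (avgCorr_message_eq_zero (fun m => c.mean₁ Q m.1)
      (g := fun m s => c.enc₁ m.1 s - c.mean₁ Q m.1) (memLp_dev₁ hX)
      fun m i => c.integral_enc₁_sub_mean₁ m.1 i)

lemma avgCorr_dev₁_add_state_noise :
    avgCorr (law n K₁ K₂ Q) (c.dev₁ Q + state) noise = 0 :=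
  avgCorr_noise_eq_zero (g := fun m s => c.enc₁ m.1 s - c.mean₁ Q m.1 + s)
    ((memLp_dev₁ hX).add memLp_state)

lemma avgCorr_message_fluct (f : Fin K₁ × Fin K₂ → Fin n → ℝ) :
    avgCorr (law n K₁ K₂ Q) (fun ω => f ω.1) (c.fluct Q) = 0 := by
  have hstate : ∀ i, ∫ s : Fin n → ℝ, s i ∂gaussPi (Fin n) Q = 0 := integral_apply_gaussPi Q
  rw [fluct, avgCorr_add_right ((memLp_dev₁ hX).add memLp_state) memLp_noise (memLp_message f),
    avgCorr_add_right (memLp_dev₁ hX) memLp_state (memLp_message f),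
    avgCorr_noise_eq_zero (g := fun m _ => f m) (memLp_message f),
    avgCorr_message_eq_zero f (g := fun _ s => s) memLp_state fun _ => hstate, add_zero, add_zero]
  exact avgCorr_message_eq_zero f (g := fun m s => c.enc₁ m.1 s - c.mean₁ Q m.1) (memLp_dev₁ hX)
    fun m i => c.integral_enc₁_sub_mean₁ m.1 i

variable [NeZero n] [NeZero K₁] [NeZero K₂]

lemma avgCorr_state_fluct : avgCorr (law n K₁ K₂ Q) state (c.fluct Q) = Q + c.stateCorr Q := by
  rw [fluct, avgCorr_add_right ((memLp_dev₁ hX).add memLp_state) memLp_noise memLp_state,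
    avgCorr_add_right (memLp_dev₁ hX) memLp_state memLp_state,
    avgCorr_noise_eq_zero (g := fun _ s => s) memLp_state, avgCorr_comm, ← stateCorr, ← avgPow,
    avgPow_state]
  ring

lemma fluctPow_eq_one_add :
    c.fluctPow Q = 1 + avgPow (law n K₁ K₂ Q) (c.dev₁ Q + state) := by
  rw [fluctPow, fluct, avgPow_add_of_avgCorr_eq_zero ((memLp_dev₁ hX).add memLp_state) memLp_noise
    (avgCorr_dev₁_add_state_noise hX), avgPow_noise, add_comm]

lemma fluctPow_eq : c.fluctPow Q = 1 + (c.var₁ Q + 2 * c.stateCorr Q + Q) := by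
  rw [fluctPow_eq_one_add hX, avgPow_add (memLp_dev₁ hX) memLp_state, avgPow_state, var₁, stateCorr]

lemma fluctPow_pos : 0 < c.fluctPow Q := by
  rw [fluctPow_eq_one_add hX]
  have := avgPow_nonneg (P := law n K₁ K₂ Q) (F := c.dev₁ Q + state)
  positivity

lemma stateCorr_sq_le : c.stateCorr Q ^ 2 ≤ c.var₁ Q * Q := by
  rw [← avgPow_state (n := n) (K₁ := K₁) (K₂ := K₂) (Q := Q)]
  exact avgCorr_sq_le (memLp_dev₁ hX) memLp_state

lemma stateCorr_eq_zero (hQ : Q = 0) : c.stateCorr Q = 0 := by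
  have h := stateCorr_sq_le hX
  rw [NNReal.coe_eq_zero.2 hQ, mul_zero] at h
  exact (pow_eq_zero_iff two_ne_zero).1 (h.antisymm (sq_nonneg _))

lemma resVar₁_nonneg : 0 ≤ c.resVar₁ Q :=
  sub_nonneg.2 (div_le_of_le_mul₀ Q.coe_nonneg c.var₁_nonneg (stateCorr_sq_le hX))

lemma mmseRatio_pos : 0 < c.mmseRatio Q := by
  have := fluctPow_pos hX
  have := resVar₁_nonneg hX
  rw [mmseRatio]
  positivity

lemma mmseRatio_eq_one (hQ : Q = 0) : c.mmseRatio Q = 1 := by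
  have hpos := fluctPow_pos hX
  have hfluct := fluctPow_eq hX
  rw [stateCorr_eq_zero hX hQ, NNReal.coe_eq_zero.2 hQ, mul_zero, add_zero, add_zero] at hfluct
  rw [mmseRatio, resVar₁, stateCorr_eq_zero hX hQ, zero_pow two_ne_zero, zero_div, sub_zero,
    ← hfluct, div_self hpos.ne']

lemma avgPow_state_sub :
    avgPow (law n K₁ K₂ Q) (state - c.mmseCoeff Q • c.fluct Q) = c.mmseRatio Q * Q := by
  have hpos := fluctPow_pos hX
  rw [mmseCoeff, ← avgCorr_state_fluct hX, fluctPow,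
    avgPow_sub_smul_div memLp_state (memLp_fluct hX) hpos.ne', avgCorr_state_fluct hX,
    avgPow_state, ← fluctPow, mmseRatio, resVar₁]
  rcases eq_or_ne Q 0 with hQ | hQ
  · simp [NNReal.coe_eq_zero.2 hQ, stateCorr_eq_zero hX hQ]
  · have hQ' : (Q : ℝ) ≠ 0 := NNReal.coe_ne_zero.2 hQ
    field_simp
    rw [fluctPow_eq hX]
    ring

end SquareIntegrable

end Statistics

section Converse

variable (Q) in
/-- The logarithm of the density ratio of two laws of the state: the Gaussian law centred at the
linear least squares estimate from output and messages, and the law of the channel. -/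
def stateLogRatio (m : Fin K₁ × Fin K₂) (s y : Fin n → ℝ) : ℝ :=
  logGauss (c.mmseRatio Q * Q) (c.mmseCoeff Q • (y - (c.mean₁ Q m.1 + c.enc₂ m.1 m.2))) s
    - logGauss Q 0 s

lemma measurable_stateLogRatio (m : Fin K₁ × Fin K₂) :
    Measurable fun p : (Fin n → ℝ) × (Fin n → ℝ) => c.stateLogRatio Q m p.1 p.2 := by
  unfold stateLogRatio
  fun_prop

lemma stateLogRatio_Y (ω : Outcome n K₁ K₂) :
    c.stateLogRatio Q ω.1 (state ω) (c.Y ω)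
      = logGauss (c.mmseRatio Q * Q) (c.mmseCoeff Q • c.fluct Q ω) (state ω)
        - logGauss Q 0 (state ω) := by
  rw [stateLogRatio, c.Y_eq_add_fluct (Q := Q), X₂, add_sub_cancel_left]

lemma avgPow_Y_sub_enc₁_add_state_add_mean₂ [NeZero n] [NeZero K₁] [NeZero K₂] :
    avgPow (law n K₁ K₂ Q) (c.Y - fun ω => c.enc₁ ω.1.1 (state ω) + state ω + c.mean₂ ω.1.1)
      = 1 + c.var₂ Q := by
  have hres : (c.Y - fun ω => c.enc₁ ω.1.1 (state ω) + state ω + c.mean₂ ω.1.1)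
      = c.dev₂ + noise := by
    funext ω
    simp only [Pi.sub_apply, Pi.add_apply, Y, X₁, dev₂, state, noise]
    abel
  rw [hres, avgPow_add_of_avgCorr_eq_zero c.memLp_dev₂ memLp_noise
    (avgCorr_noise_eq_zero (g := fun m _ => c.enc₂ m.1 m.2 - c.mean₂ m.1) c.memLp_dev₂),
    avgPow_noise, add_comm, var₂]

variable {c} (hX : MemLp c.X₁ 2 (law n K₁ K₂ Q))
include hX

lemma memLp_Y : MemLp c.Y 2 (law n K₁ K₂ Q) :=
  ((hX.add c.memLp_X₂).add memLp_state).add memLp_noise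

lemma avgPow_Y_sub (f : Fin K₁ → Fin n → ℝ) :
    avgPow (law n K₁ K₂ Q) (c.Y - fun ω => f ω.1.1)
      = c.fluctPow Q
        + avgPow (law n K₁ K₂ Q) (fun ω => c.mean₁ Q ω.1.1 + c.X₂ ω - f ω.1.1) := by
  have hsplit : c.Y - (fun ω => f ω.1.1)
      = (fun ω => c.mean₁ Q ω.1.1 + c.X₂ ω - f ω.1.1) + c.fluct Q := by
    funext ω
    simp only [Pi.sub_apply, Pi.add_apply, c.Y_eq_add_fluct (Q := Q)]
    abel
  rw [hsplit, fluctPow, add_comm (avgPow _ _)]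
  exact avgPow_add_of_avgCorr_eq_zero
    (memLp_message fun m => c.mean₁ Q m.1 + c.enc₂ m.1 m.2 - f m.1) (memLp_fluct hX)
    (avgCorr_message_fluct hX fun m => c.mean₁ Q m.1 + c.enc₂ m.1 m.2 - f m.1)

variable [NeZero K₁] [NeZero K₂]

lemma integrable_stateLogRatio :
    Integrable (fun ω => c.stateLogRatio Q ω.1 (state ω) (c.Y ω)) (law n K₁ K₂ Q) := by
  simp only [stateLogRatio_Y]
  refine Integrable.sub ?_ ?_
  · exact integrable_logGauss _ ((memLp_fluct hX).const_smul (c.mmseCoeff Q)) memLp_state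
  · exact integrable_logGauss _ .zero memLp_state

lemma integrable_logGauss_Y_sub_noise (v : ℝ) {F : Outcome n K₁ K₂ → Fin n → ℝ}
    (hF : MemLp F 2 (law n K₁ K₂ Q)) :
    Integrable (fun ω => logGauss v (F ω) (c.Y ω) - logGauss 1 0 (noise ω)) (law n K₁ K₂ Q) :=
  (integrable_logGauss v hF (memLp_Y hX)).sub (integrable_logGauss 1 .zero memLp_noise)

variable [NeZero n]

lemma lintegral_exp_stateLogRatio_le (m : Fin K₁ × Fin K₂) (y : Fin n → ℝ) :
    ∫⁻ s, .ofReal (rexp (c.stateLogRatio Q m s y)) ∂gaussPi (Fin n) Q ≤ 1 :=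
  lintegral_exp_logGauss_sub_le (mmseRatio_pos hX) _

lemma integral_stateLogRatio :
    ∫ ω, c.stateLogRatio Q ω.1 (state ω) (c.Y ω) ∂law n K₁ K₂ Q
      = -(n / 2 * log (c.mmseRatio Q)) := by
  simp only [stateLogRatio_Y]
  rcases eq_or_ne Q 0 with hQ | hQ
  · rw [mmseRatio_eq_one hX hQ]
    simp [hQ, logGauss]
  · have hQ' : (Q : ℝ) ≠ 0 := NNReal.coe_ne_zero.2 hQ
    have h := integral_logGauss_sub_logGauss ((memLp_fluct hX).const_smul (c.mmseCoeff Q))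
      memLp_state .zero memLp_state (avgPow_state_sub hX) (by rw [sub_zero]; exact avgPow_state)
      (mul_ne_zero (mmseRatio_pos hX).ne' hQ') hQ'
    rwa [mul_div_cancel_right₀ _ hQ', Fintype.card_fin] at h

lemma integral_logGauss_Y_sub_noise {v : ℝ} (hv : v ≠ 0) {F : Outcome n K₁ K₂ → Fin n → ℝ}
    (hF : MemLp F 2 (law n K₁ K₂ Q)) (hpow : avgPow (law n K₁ K₂ Q) (c.Y - F) = v) :
    ∫ ω, (logGauss v (F ω) (c.Y ω) - logGauss 1 0 (noise ω)) ∂law n K₁ K₂ Q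
      = -(n / 2 * log v) := by
  have h := integral_logGauss_sub_logGauss hF (memLp_Y hX) .zero memLp_noise hpow
    (by rw [sub_zero]; exact avgPow_noise) hv one_ne_zero
  rwa [div_one, Fintype.card_fin] at h

/-- The decoder is compared with one that knows the state. -/
theorem mul_log_card₂_le_log_one_add_var₂ :
    (1 - c.errorProb Q) * log K₂ - log 2 ≤ n / 2 * log (1 + c.var₂ Q) := by
  have hvar : 0 < 1 + c.var₂ Q := by
    have := c.var₂_nonneg (Q := Q)
    positivity
  have hcenter : MemLp (fun ω => c.enc₁ ω.1.1 (state ω) + state ω + c.mean₂ ω.1.1) 2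
      (law n K₁ K₂ Q) := (hX.add memLp_state).add c.memLp_mean₂
  have hmeas : ∀ m₁, Measurable fun p : (Fin n → ℝ) × (Fin n → ℝ) =>
      logGauss (1 + c.var₂ Q) (c.enc₁ m₁ p.1 + p.1 + c.mean₂ m₁) p.2 := fun m₁ => by
    have := c.measurable_enc₁ m₁
    fun_prop
  have h := c.integral_add_mul_log_le_of_reference
    (W := fun m s y => logGauss (1 + c.var₂ Q) (c.enc₁ m.1 s + s + c.mean₂ m.1) y)
    (fun m => hmeas m.1) (integrable_logGauss_Y_sub_noise hX _ hcenter)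
    (fun m => by simp [lintegral_exp_logGauss hvar]) (NeZero.pos K₁) ?_
  · rw [integral_logGauss_Y_sub_noise hX hvar.ne' hcenter c.avgPow_Y_sub_enc₁_add_state_add_mean₂,
      mul_div_cancel_left₀ _ (NeZero.ne (K₁ : ℝ))] at h
    linarith
  · rw [← lintegral_finsetSum _ fun m _ => (hmeas m.1).exp.ennreal_ofReal.lintegral_prod_right']
    calc _ ≤ ∫⁻ _, (K₁ : ℝ≥0∞) ∂gaussPi (Fin n) Q := lintegral_mono fun s => by
          simpa using sum_setLIntegral_preimage_singleton_le_card c.measurable_dec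
            fun m₁ => (lintegral_exp_logGauss hvar (c.enc₁ m₁ s + s + c.mean₂ m₁)).le
      _ = K₁ := by simp

/-- The chain rule for mutual information is replaced by a product reference law: a Gaussian output
centred at `f`, and the state distributed around its estimate from output and messages. -/
theorem mul_log_card_div_le_log_mul_mmseRatio (f : Fin K₁ → Fin n → ℝ) {v : ℝ}
    (hv : c.fluctPow Q
      + avgPow (law n K₁ K₂ Q) (fun ω => c.mean₁ Q ω.1.1 + c.X₂ ω - f ω.1.1) = v)
    {J : ℕ} (hJ : 0 < J)
    (hdec : ∑ m, ∫⁻ y in c.dec ⁻¹' {m}, .ofReal (rexp (logGauss v (f m.1) y)) ≤ (J : ℝ≥0∞)) :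
    (1 - c.errorProb Q) * log (K₁ * K₂ / J) - log 2 ≤ n / 2 * log (v * c.mmseRatio Q) := by
  have hv0 : 0 < v := hv ▸ add_pos_of_pos_of_nonneg (fluctPow_pos hX) avgPow_nonneg
  have hf : MemLp (fun ω => f ω.1.1) 2 (law n K₁ K₂ Q) := memLp_message fun m => f m.1
  have hfmeas : ∀ m₁, Measurable (logGauss v (f m₁)) := fun m₁ => by fun_prop
  have hsplit : ∀ ω, logGauss v (f ω.1.1) (c.Y ω) + c.stateLogRatio Q ω.1 (state ω) (c.Y ω)
        - logGauss 1 0 (noise ω)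
      = (logGauss v (f ω.1.1) (c.Y ω) - logGauss 1 0 (noise ω))
        + c.stateLogRatio Q ω.1 (state ω) (c.Y ω) := fun ω => add_sub_right_comm _ _ _
  have hint := integrable_logGauss_Y_sub_noise hX v hf
  have hmarginal : ∀ (m : Fin K₁ × Fin K₂) (B : Set (Fin n → ℝ)),
      ∫⁻ s, ∫⁻ y in B, .ofReal (rexp (logGauss v (f m.1) y + c.stateLogRatio Q m s y)) ∂volume
        ∂gaussPi (Fin n) Q ≤ ∫⁻ y in B, .ofReal (rexp (logGauss v (f m.1) y)) := fun m B =>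
    lintegral_lintegral_exp_add_le (hfmeas m.1) (c.measurable_stateLogRatio m)
      (lintegral_exp_stateLogRatio_le hX m)
  have h := c.integral_add_mul_log_le_of_reference
    (W := fun m s y => logGauss v (f m.1) y + c.stateLogRatio Q m s y)
    (fun m => ((hfmeas m.1).comp measurable_snd).add (c.measurable_stateLogRatio m))
    ((integrable_congr (ae_of_all _ hsplit)).2 (hint.add (integrable_stateLogRatio hX)))
    (fun m => by
      simpa only [Measure.restrict_univ, lintegral_exp_logGauss hv0] using hmarginal m .univ) hJ
    ((Finset.sum_le_sum fun m _ => hmarginal m _).trans hdec)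
  simp only [hsplit] at h
  rw [integral_add hint (integrable_stateLogRatio hX), integral_stateLogRatio hX,
    integral_logGauss_Y_sub_noise hX hv0.ne' hf ((avgPow_Y_sub hX f).trans hv)] at h
  rw [log_mul hv0.ne' (mmseRatio_pos hX).ne']
  linarith

theorem mul_log_card₂_le_log_mul_mmseRatio :
    (1 - c.errorProb Q) * log K₂ - log 2
      ≤ n / 2 * log ((c.fluctPow Q + c.var₂ Q) * c.mmseRatio Q) := by
  have hpos : 0 < c.fluctPow Q + c.var₂ Q :=
    add_pos_of_pos_of_nonneg (fluctPow_pos hX) c.var₂_nonneg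
  have h := mul_log_card_div_le_log_mul_mmseRatio hX (fun m₁ => c.mean₁ Q m₁ + c.mean₂ m₁)
    (v := c.fluctPow Q + c.var₂ Q) ?_ (NeZero.pos K₁) ?_
  · rwa [mul_div_cancel_left₀ _ (NeZero.ne (K₁ : ℝ))] at h
  · simp only [add_sub_add_left_eq_sub]
    rfl
  · simpa using sum_setLIntegral_preimage_singleton_le_card c.measurable_dec
      fun m₁ => (lintegral_exp_logGauss hpos (c.mean₁ Q m₁ + c.mean₂ m₁)).le

theorem mul_log_card_mul_card_le_log_mul_mmseRatio :
    (1 - c.errorProb Q) * log (K₁ * K₂) - log 2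
      ≤ n / 2 * log ((c.fluctPow Q
          + (c.var₂ Q + avgPow (law n K₁ K₂ Q) fun ω => c.mean₁ Q ω.1.1 + c.mean₂ ω.1.1))
        * c.mmseRatio Q) := by
  have hpos : 0 < c.fluctPow Q
      + (c.var₂ Q + avgPow (law n K₁ K₂ Q) fun ω => c.mean₁ Q ω.1.1 + c.mean₂ ω.1.1) :=
    add_pos_of_pos_of_nonneg (fluctPow_pos hX) (add_nonneg c.var₂_nonneg avgPow_nonneg)
  have h := mul_log_card_div_le_log_mul_mmseRatio hX 0
    (v := c.fluctPow Q
      + (c.var₂ Q + avgPow (law n K₁ K₂ Q) fun ω => c.mean₁ Q ω.1.1 + c.mean₂ ω.1.1))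
    ?_ one_pos ?_
  · rwa [Nat.cast_one, div_one] at h
  · rw [add_comm (c.var₂ Q), ← c.avgPow_add_dev₂ fun m₁ => c.mean₁ Q m₁ + c.mean₂ m₁]
    simp only [Pi.zero_apply, sub_zero, X₂_eq_add_dev₂, Pi.add_apply, ← add_assoc]
    rfl
  · rw [Nat.cast_one, ← lintegral_exp_logGauss hpos (0 : Fin n → ℝ)]
    exact sum_setLIntegral_preimage_singleton_le c.measurable_dec _ _

end Converse

section Power

variable {c} {P₁ P₂ : ℝ≥0}

lemma PowerConstraint.memLp_X₁ (hP : c.PowerConstraint P₁ P₂ Q) :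
    MemLp c.X₁ 2 (law n K₁ K₂ Q) :=
  .of_eval fun i => (memLp_two_iff_integrable_sq
    ((measurable_pi_apply i).comp c.measurable_X₁).aestronglyMeasurable).2 (hP.1 i)

variable [NeZero n]

lemma avgPow_le_of_sum_le {F : Outcome n K₁ K₂ → Fin n → ℝ} (hF : MemLp F 2 (law n K₁ K₂ Q))
    {P : ℝ} (h : ∑ i, ∫ ω, F ω i ^ 2 ∂law n K₁ K₂ Q ≤ n * P) :
    avgPow (law n K₁ K₂ Q) F ≤ P := by
  simp only [sq] at h
  rw [avgPow, avgCorr_eq_sum hF hF, Fintype.card_fin]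
  exact (inv_mul_le_iff₀ (Nat.cast_pos.2 (NeZero.pos n))).2 h

lemma PowerConstraint.meanPow₁_add_var₁_le (hP : c.PowerConstraint P₁ P₂ Q) :
    c.meanPow₁ Q + c.var₁ Q ≤ P₁ :=
  avgPow_X₁ hP.memLp_X₁ ▸ avgPow_le_of_sum_le hP.memLp_X₁ hP.2.1

lemma PowerConstraint.meanPow₂_add_var₂_le [NeZero K₂] (hP : c.PowerConstraint P₁ P₂ Q) :
    c.meanPow₂ Q + c.var₂ Q ≤ P₂ := by
  rw [meanPow₂, ← avgPow_add_dev₂, ← X₂_eq_add_dev₂]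
  exact avgPow_le_of_sum_le c.memLp_X₂ hP.2.2.2

end Power

end DegradedCode

section Region

/-- The correlation parameters `(ρ₁, ρ₂, ρs)`. -/
def corrParams : Set (ℝ × ℝ × ℝ) :=
  (Set.Icc 0 1 ×ˢ (Set.Icc 0 1 ×ˢ Set.Icc (-1) 0)) ∩ {ρ | ρ.1 ^ 2 + ρ.2.2 ^ 2 ≤ 1}

/-- The power that encoder 1 spends neither on the common message nor on cancelling the state. -/
def resPow (P₁ : ℝ≥0) (ρ : ℝ × ℝ × ℝ) : ℝ := P₁ * (1 - ρ.1 ^ 2 - ρ.2.2 ^ 2)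

/-- The power of the state after its partial cancellation by encoder 1. -/
def statePow (P₁ Q : ℝ≥0) (ρ : ℝ × ℝ × ℝ) : ℝ := (√(Q : ℝ) + ρ.2.2 * √(P₁ : ℝ)) ^ 2

/-- The power that encoder 2 spends on its private message. -/
def privPow (P₂ : ℝ≥0) (ρ : ℝ × ℝ × ℝ) : ℝ := P₂ * (1 - ρ.2.1 ^ 2)

/-- The power of the coherently combined signals for the common message. -/
def cohPow (P₁ P₂ : ℝ≥0) (ρ : ℝ × ℝ × ℝ) : ℝ := (ρ.2.1 * √(P₂ : ℝ) + ρ.1 * √(P₁ : ℝ)) ^ 2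

/-- The three rate inequalities of the outer bound for fixed correlation parameters. -/
def RateBounds (b : ℝ) (P₁ P₂ Q : ℝ≥0) (ρ : ℝ × ℝ × ℝ) (R : ℝ × ℝ) : Prop :=
  R.2 ≤ 1 / 2 * logb b (1 + privPow P₂ ρ) ∧
  R.2 ≤ 1 / 2 * logb b (1 + resPow P₁ ρ)
      + 1 / 2 * logb b (1 + privPow P₂ ρ / (1 + statePow P₁ Q ρ + resPow P₁ ρ)) ∧
  R.1 + R.2 ≤ 1 / 2 * logb b (1 + resPow P₁ ρ)
      + 1 / 2 * logb b (1 + (privPow P₂ ρ + cohPow P₁ P₂ ρ)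
        / (1 + statePow P₁ Q ρ + resPow P₁ ρ))

variable {b : ℝ} {P₁ P₂ Q : ℝ≥0} {ρ : ℝ × ℝ × ℝ}

lemma isCompact_corrParams : IsCompact corrParams :=
  (isCompact_Icc.prod (isCompact_Icc.prod isCompact_Icc)).inter_right
    (isClosed_le (by fun_prop) continuous_const)

lemma resPow_nonneg (hρ : ρ ∈ corrParams) : 0 ≤ resPow P₁ ρ :=
  mul_nonneg P₁.2 (by have : ρ.1 ^ 2 + ρ.2.2 ^ 2 ≤ 1 := hρ.2; linarith)

lemma statePow_nonneg : 0 ≤ statePow P₁ Q ρ := sq_nonneg _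

lemma privPow_nonneg (hρ : ρ ∈ corrParams) : 0 ≤ privPow P₂ ρ := by
  obtain ⟨h0, h1⟩ := hρ.1.2.1
  exact mul_nonneg P₂.2 (sub_nonneg.2 (pow_le_one₀ h0 h1))

lemma cohPow_nonneg : 0 ≤ cohPow P₁ P₂ ρ := sq_nonneg _

lemma one_add_statePow_add_resPow_pos (hρ : ρ ∈ corrParams) :
    0 < 1 + statePow P₁ Q ρ + resPow P₁ ρ := by
  have := resPow_nonneg (P₁ := P₁) hρ
  have := statePow_nonneg (P₁ := P₁) (Q := Q) (ρ := ρ)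
  positivity

@[fun_prop]
lemma continuous_resPow : Continuous (resPow P₁) := by
  unfold resPow
  fun_prop

@[fun_prop]
lemma continuous_statePow : Continuous (statePow P₁ Q) := by
  unfold statePow
  fun_prop

@[fun_prop]
lemma continuous_privPow : Continuous (privPow P₂) := by
  unfold privPow
  fun_prop

@[fun_prop]
lemma continuous_cohPow : Continuous (cohPow P₁ P₂) := by
  unfold cohPow
  fun_prop

lemma continuous_logb_one_add {X : Type*} [TopologicalSpace X] {f : X → ℝ} (hf : Continuous f)
    (h0 : ∀ x, 0 ≤ f x) : Continuous fun x => logb b (1 + f x) :=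
  ((continuous_const.add hf).log fun x => (add_pos_of_pos_of_nonneg one_pos (h0 x)).ne').div_const _

lemma isClosed_setOf_exists_rateBounds (b : ℝ) (P₁ P₂ Q : ℝ≥0) :
    IsClosed {R : ℝ × ℝ | ∃ ρ ∈ corrParams, RateBounds b P₁ P₂ Q ρ R} := by
  have := isCompact_iff_compactSpace.1 isCompact_corrParams
  have hpos : ∀ x : corrParams × ℝ × ℝ, 0 < 1 + statePow P₁ Q x.1 + resPow P₁ x.1 :=
    fun x => one_add_statePow_add_resPow_pos x.1.2
  have hpriv : ∀ x : corrParams × ℝ × ℝ, 0 ≤ privPow P₂ x.1 := fun x => privPow_nonneg x.1.2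
  have hres : ∀ x : corrParams × ℝ × ℝ, 0 ≤ resPow P₁ x.1 := fun x => resPow_nonneg x.1.2
  have hquot : ∀ {f : corrParams × ℝ × ℝ → ℝ}, Continuous f → (∀ x, 0 ≤ f x) →
      Continuous fun x : corrParams × ℝ × ℝ => 1 / 2 * logb b (1 + resPow P₁ x.1)
        + 1 / 2 * logb b (1 + f x / (1 + statePow P₁ Q x.1 + resPow P₁ x.1)) := fun hf h0 =>
    ((continuous_logb_one_add (by fun_prop) hres).const_mul _).add
      ((continuous_logb_one_add (hf.div (by fun_prop) fun x => (hpos x).ne')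
        fun x => div_nonneg (h0 x) (hpos x).le).const_mul _)
  have hclosed : IsClosed {x : corrParams × ℝ × ℝ | RateBounds b P₁ P₂ Q x.1 x.2} :=
    (isClosed_le (by fun_prop)
        ((continuous_logb_one_add (by fun_prop) hpriv).const_mul _)).inter
      ((isClosed_le (by fun_prop) (hquot (by fun_prop) hpriv)).inter
        (isClosed_le (by fun_prop)
          (hquot (by fun_prop) fun x => add_nonneg (hpriv x) cohPow_nonneg)))
  convert isClosedMap_snd_of_compactSpace _ hclosed using 1
  ext R
  constructor
  · rintro ⟨ρ, hρ, h⟩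
    exact ⟨(⟨ρ, hρ⟩, R), h, rfl⟩
  · rintro ⟨⟨ρ, R'⟩, h, rfl⟩
    exact ⟨ρ, ρ.2, h⟩

lemma sqrt_div_mul_sqrt {x P : ℝ} (hx : 0 ≤ x) (hxP : x ≤ P) : √(x / P) * √P = √x := by
  rw [← sqrt_mul (div_nonneg hx (hx.trans hxP)), div_mul_cancel_of_imp fun h => by linarith]

lemma mul_sq_sqrt_div {x P : ℝ} (hx : 0 ≤ x) (hxP : x ≤ P) : P * √(x / P) ^ 2 = x := by
  rw [sq_sqrt (div_nonneg hx (hx.trans hxP)), mul_div_cancel_of_imp' fun h => by linarith]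

lemma sqrt_div_mem_Icc {x P : ℝ} (hx : 0 ≤ x) (hxP : x ≤ P) : √(x / P) ∈ Set.Icc (0 : ℝ) 1 :=
  ⟨sqrt_nonneg _, sqrt_le_one.2 (div_le_one_of_le₀ hxP (hx.trans hxP))⟩

lemma sq_sqrt_sub_sqrt_div_le {q k : ℝ} (hq : 0 ≤ q) (hk : q = 0 → k = 0) :
    (√q - √(k ^ 2 / q)) ^ 2 ≤ q + 2 * k + k ^ 2 / q := by
  have hmul : √q * √(k ^ 2 / q) = |k| := by
    rw [← sqrt_mul hq, mul_div_cancel_of_imp' fun h => by rw [hk h, zero_pow two_ne_zero],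
      sqrt_sq_eq_abs]
  rw [sub_sq, mul_assoc, hmul, sq_sqrt hq, sq_sqrt (by positivity)]
  linarith [neg_abs_le k]

/-- The witness is `(√(p₁ / P₁), √(p₂ / P₂), -√(k² / (Q P₁)))`: of the power of encoder 1, `p₁` goes
to the common message and `k² / Q` to the state. -/
lemma exists_corrParams {p₁ p₂ v₁ v₂ k : ℝ} (hp₁ : 0 ≤ p₁) (hp₂ : 0 ≤ p₂) (hv₁ : 0 ≤ v₁)
    (hv₂ : 0 ≤ v₂) (h₁ : p₁ + v₁ ≤ P₁) (h₂ : p₂ + v₂ ≤ P₂) (hk : k ^ 2 ≤ v₁ * Q) :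
    ∃ ρ ∈ corrParams, v₁ - k ^ 2 / Q ≤ resPow P₁ ρ ∧ v₂ ≤ privPow P₂ ρ ∧
      cohPow P₁ P₂ ρ = (√p₁ + √p₂) ^ 2 ∧ statePow P₁ Q ρ ≤ Q + 2 * k + k ^ 2 / Q := by
  have hQ : (0 : ℝ) ≤ Q := Q.2
  have hkQ : k ^ 2 / Q ≤ v₁ := div_le_of_le_mul₀ hQ hv₁ hk
  have hkQ0 : 0 ≤ k ^ 2 / Q := by positivity
  have hp₁P : p₁ ≤ P₁ := by linarith
  have hp₂P : p₂ ≤ P₂ := by linarith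
  have hkP : k ^ 2 / Q ≤ P₁ := by linarith
  have hρs := sqrt_div_mem_Icc hkQ0 hkP
  refine ⟨(√(p₁ / P₁), √(p₂ / P₂), -√(k ^ 2 / Q / P₁)), ⟨⟨sqrt_div_mem_Icc hp₁ hp₁P,
    sqrt_div_mem_Icc hp₂ hp₂P, neg_le_neg hρs.2, neg_nonpos.2 hρs.1⟩, ?_⟩, ?_, ?_, ?_, ?_⟩
  · rw [Set.mem_ofPred_eq, neg_sq, sq_sqrt (by positivity), sq_sqrt (by positivity), ← add_div]
    exact div_le_one_of_le₀ (by linarith) P₁.2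
  · simp only [resPow, neg_sq, mul_sub, mul_sq_sqrt_div hp₁ hp₁P, mul_sq_sqrt_div hkQ0 hkP]
    linarith
  · simp only [privPow, mul_sub, mul_sq_sqrt_div hp₂ hp₂P]
    linarith
  · simp only [cohPow, sqrt_div_mul_sqrt hp₁ hp₁P, sqrt_div_mul_sqrt hp₂ hp₂P, add_comm (√p₁)]
  · rw [statePow, neg_mul, sqrt_div_mul_sqrt hkQ0 hkP, ← sub_eq_add_neg]
    exact sq_sqrt_sub_sqrt_div_le hQ fun h => by simpa [h, sq_nonpos_iff] using hk

/-- `A` is the power of the state left in the output, `T` the residual power of encoder 1, `N` the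
signal power; unlike the product on the left, the bound is visibly monotone in `A`, `T` and `N`. -/
lemma add_mul_div_le {N N' A A' T T' : ℝ} (hN : 0 ≤ N) (hNN : N ≤ N') (hA : 0 ≤ A') (hAA : A' ≤ A)
    (hT : 0 ≤ T) (hTT : T ≤ T') :
    (1 + A + T + N) * ((1 + T) / (1 + A + T)) ≤ (1 + T') * (1 + N' / (1 + A' + T')) := by
  have hpos : 0 < 1 + A + T := by linarith
  have hratio : (1 + T) / (1 + A + T) ≤ (1 + T') / (1 + A' + T') := by
    rw [div_le_div_iff₀ hpos (by linarith)]
    nlinarith [mul_le_mul (add_le_add_right hTT 1) hAA hA (by linarith)]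
  calc _ = (1 + T) + N * ((1 + T) / (1 + A + T)) := by
        rw [add_mul _ N, mul_div_cancel₀ _ hpos.ne']
    _ ≤ (1 + T') + N' * ((1 + T') / (1 + A' + T')) := by gcongr; linarith
    _ = _ := by ring

lemma le_half_logb_of_mul_le {n x y r : ℝ} (hb : 1 < b) (hn : 0 < n) (hx : 0 < x) (hxy : x ≤ y)
    (h : n * r * log b ≤ n / 2 * log x) : r ≤ 1 / 2 * logb b y := by
  have hlog := log_le_log hx hxy
  rw [logb, ← mul_div_assoc, le_div_iff₀ (log_pos hb)]
  refine le_of_mul_le_mul_left ?_ hn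
  calc n * (r * log b) ≤ n / 2 * log x := by rwa [← mul_assoc]
    _ ≤ n / 2 * log y := by gcongr
    _ = n * (1 / 2 * log y) := by ring

end Region

namespace DegradedCode

variable {n K₁ K₂ : ℕ} [NeZero n] [NeZero K₁] [NeZero K₂] {P₁ P₂ Q : ℝ≥0}
  {c : DegradedCode n K₁ K₂}

lemma PowerConstraint.exists_corrParams (hP : c.PowerConstraint P₁ P₂ Q) :
    ∃ ρ ∈ corrParams, c.resVar₁ Q ≤ resPow P₁ ρ ∧ c.var₂ Q ≤ privPow P₂ ρ ∧
      avgPow (law n K₁ K₂ Q) (fun ω => c.mean₁ Q ω.1.1 + c.mean₂ ω.1.1) ≤ cohPow P₁ P₂ ρ ∧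
      statePow P₁ Q ρ ≤ c.fluctPow Q - 1 - c.resVar₁ Q := by
  obtain ⟨ρ, hρ, hres, hpriv, hcoh, hstate⟩ := DirtyMAC.exists_corrParams c.meanPow₁_nonneg
    c.meanPow₂_nonneg c.var₁_nonneg c.var₂_nonneg hP.meanPow₁_add_var₁_le hP.meanPow₂_add_var₂_le
    (stateCorr_sq_le hP.memLp_X₁)
  refine ⟨ρ, hρ, hres, hpriv, ?_, hstate.trans_eq ?_⟩
  · rw [hcoh]
    exact avgPow_add_le_sq_sqrt_add_sqrt c.memLp_mean₁ c.memLp_mean₂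
  · rw [fluctPow_eq hP.memLp_X₁, resVar₁]
    ring

theorem PowerConstraint.exists_rateBounds (hP : c.PowerConstraint P₁ P₂ Q) {b : ℝ} (hb : 1 < b)
    {R : ℝ × ℝ} (hR₂ : n * R.2 * log b ≤ (1 - c.errorProb Q) * log K₂ - log 2)
    (hR : n * (R.1 + R.2) * log b ≤ (1 - c.errorProb Q) * log (K₁ * K₂) - log 2) :
    ∃ ρ ∈ corrParams, RateBounds b P₁ P₂ Q ρ R := by
  obtain ⟨ρ, hρ, hres, hpriv, hcoh, hstate⟩ := hP.exists_corrParams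
  have hX := hP.memLp_X₁
  have hn : (0 : ℝ) < n := Nat.cast_pos.2 (NeZero.pos n)
  have hvar₂ := c.var₂_nonneg (Q := Q)
  have hres0 := resPow_nonneg (P₁ := P₁) hρ
  have hden := one_add_statePow_add_resPow_pos (P₁ := P₁) (Q := Q) hρ
  have hgain : ∀ {N N' r : ℝ}, 0 ≤ N → N ≤ N' →
      n * r * log b ≤ n / 2 * log ((c.fluctPow Q + N) * c.mmseRatio Q) →
      r ≤ 1 / 2 * logb b (1 + resPow P₁ ρ)
        + 1 / 2 * logb b (1 + N' / (1 + statePow P₁ Q ρ + resPow P₁ ρ)) := by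
    intro N N' r hN hNN h
    have hN' := hN.trans hNN
    have hle := add_mul_div_le hN hNN statePow_nonneg hstate (resVar₁_nonneg hX) hres
    rw [show 1 + (c.fluctPow Q - 1 - c.resVar₁ Q) + c.resVar₁ Q = c.fluctPow Q by ring,
      ← mmseRatio] at hle
    rw [← mul_add, ← logb_mul (by positivity) (by positivity)]
    exact le_half_logb_of_mul_le hb hn
      (mul_pos (add_pos_of_pos_of_nonneg (fluctPow_pos hX) hN) (mmseRatio_pos hX)) hle h
  exact ⟨ρ, hρ,
    le_half_logb_of_mul_le hb hn (by linarith) (by linarith)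
      (hR₂.trans (mul_log_card₂_le_log_one_add_var₂ hX)),
    hgain hvar₂ hpriv (hR₂.trans (mul_log_card₂_le_log_mul_mmseRatio hX)),
    hgain (add_nonneg hvar₂ avgPow_nonneg) (add_le_add hpriv hcoh)
      (hR.trans (mul_log_card_mul_card_le_log_mul_mmseRatio hX))⟩

end DegradedCode

lemma mul_log_le_log_of_rpow_le {b x y : ℝ} (hb : 0 < b) (h : b ^ x ≤ y) : x * log b ≤ log y := by
  rw [← log_rpow hb]
  exact log_le_log (rpow_pos_of_pos hb x) h

/-- The rate pairs of the codes, corrected by the loss `log 2 / n` and the factor `1 - ε`, converge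
to the achievable pair, and the outer bound is closed. -/
theorem Achievable.exists_rateBounds {b : ℝ} (hb : 1 < b) {P₁ P₂ Q : ℝ≥0} {R : ℝ × ℝ}
    (h : Achievable b P₁ P₂ Q R) : ∃ ρ ∈ corrParams, RateBounds b P₁ P₂ Q ρ R := by
  obtain ⟨-, -, K₁, K₂, c, hK₁, hK₂, hP, herr⟩ := h
  have hb0 : 0 < b := one_pos.trans hb
  have hlogb : 0 < log b := log_pos hb
  have hsucc : Tendsto (fun n => 1 - (c n).errorProb Q) atTop (𝓝 1) := by
    simpa using herr.const_sub 1
  have hlim : Tendsto (fun n : ℕ => ((1 - (c n).errorProb Q) * R.1,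
      (1 - (c n).errorProb Q) * R.2 - log 2 / log b / n)) atTop (𝓝 R) := by
    simpa using (hsucc.mul_const R.1).prodMk_nhds
      ((hsucc.mul_const R.2).sub (tendsto_const_div_atTop_nhds_zero_nat (log 2 / log b)))
  refine (isClosed_setOf_exists_rateBounds b P₁ P₂ Q).mem_of_tendsto hlim ?_
  filter_upwards [eventually_gt_atTop 0] with n hn
  have hk₁ : (0 : ℝ) < K₁ n := (rpow_pos_of_pos hb0 _).trans_le (hK₁ n)
  have hk₂ : (0 : ℝ) < K₂ n := (rpow_pos_of_pos hb0 _).trans_le (hK₂ n)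
  have : NeZero n := ⟨hn.ne'⟩
  have : NeZero (K₁ n) := ⟨fun h => by simp [h] at hk₁⟩
  have : NeZero (K₂ n) := ⟨fun h => by simp [h] at hk₂⟩
  have hsucc0 : 0 ≤ 1 - (c n).errorProb Q := sub_nonneg.2 measureReal_le_one
  have hlog₁ := mul_le_mul_of_nonneg_left (mul_log_le_log_of_rpow_le hb0 (hK₁ n)) hsucc0
  have hlog₂ := mul_le_mul_of_nonneg_left (mul_log_le_log_of_rpow_le hb0 (hK₂ n)) hsucc0
  have hloss : n * (log 2 / log b / n) * log b = log 2 := by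
    have : (n : ℝ) ≠ 0 := Nat.cast_ne_zero.2 hn.ne'
    field_simp
  refine (hP n).exists_rateBounds hb ?_ ?_
  · linarith
  · rw [log_mul hk₁.ne' hk₂.ne']
    linarith

end DirtyMAC

end

theorem theorem5 (b : ℝ) (hb : 1 < b) (P₁ P₂ Q : ℝ≥0) (R₁ R₂ : ℝ)
    (hR : (R₁, R₂) ∈ DirtyMAC.capacityRegionDeg b P₁ P₂ Q) :
    ∃ ρ₁ ∈ Set.Icc (0 : ℝ) 1, ∃ ρ₂ ∈ Set.Icc (0 : ℝ) 1, ∃ ρs ∈ Set.Icc (-1 : ℝ) 0,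
      ρ₁ ^ 2 + ρs ^ 2 ≤ 1 ∧
      R₂ ≤ 1 / 2 * Real.logb b (1 + P₂ * (1 - ρ₂ ^ 2)) ∧
      R₂ ≤ 1 / 2 * Real.logb b (1 + P₁ * (1 - ρ₁ ^ 2 - ρs ^ 2))
          + 1 / 2 * Real.logb b (1 + P₂ * (1 - ρ₂ ^ 2)
            / (1 + (√(Q : ℝ) + ρs * √(P₁ : ℝ)) ^ 2 + P₁ * (1 - ρ₁ ^ 2 - ρs ^ 2))) ∧
      R₁ + R₂ ≤ 1 / 2 * Real.logb b (1 + P₁ * (1 - ρ₁ ^ 2 - ρs ^ 2))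
          + 1 / 2 * Real.logb b (1 + (P₂ * (1 - ρ₂ ^ 2) + (ρ₂ * √(P₂ : ℝ) + ρ₁ * √(P₁ : ℝ)) ^ 2)
            / (1 + (√(Q : ℝ) + ρs * √(P₁ : ℝ)) ^ 2 + P₁ * (1 - ρ₁ ^ 2 - ρs ^ 2))) := by
  obtain ⟨ρ, hρ, h⟩ := closure_minimal
    (fun R hR => DirtyMAC.Achievable.exists_rateBounds hb hR)
    (DirtyMAC.isClosed_setOf_exists_rateBounds b P₁ P₂ Q) hR
  exact ⟨ρ.1, hρ.1.1, ρ.2.1, hρ.1.2.1, ρ.2.2, hρ.1.2.2, hρ.2, h⟩
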